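/- Let $M\ge N$ be non-negative integers, and let either $\beta=1$ and $\mathbb{K}=\mathbb{R}$, or $\beta=2$ and $\mathbb{K}=\mathbb{C}$. Write $A^\dagger$ for the conjugate transpose of a matrix $A$ (the transpose if $\beta=1$), and $|dX|$, $|dG|$ for Lebesgue measure on the spaces of $M\times N$ and $N\times N$ matrices over $\mathbb{K}$. On a common probability space, let $U$ be a random $N\times N$ unitary (real orthogonal if $\beta=1$) matrix distributed according to Haar measure, and let $X$ be a random $M\times N$ matrix over $\mathbb{K}$, independent of $U$, whose distribution is the probability measure \[ d\nu(X)\propto \exp\left(-\tfrac{\beta}{2}\operatorname{Tr}X^\dagger X\right)|dX|. \] Then the $N\times N$ random matrix $G=U(X^\dagger X)^{1/2}$, where $(X^\dagger X)^{1/2}$ is the positive semidefinite square root, has the induced Ginibre distribution with parameter $L=M-N$, that is, its distribution is the probability measure \[ d\mu_{\mathrm{IndG}}(G)\propto (\det G^\dagger G)^{\frac{\beta}{2}(M-N)}\exp\left(-\tfrac{\beta}{2}\operatorname{Tr}G^\dagger G\right)|dG|. \] -/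

import Mathlib

open MeasureTheory ProbabilityTheory
open scoped Matrix MatrixOrder

namespace InducedGinibre

/-- Matrices carry the product sigma-algebra of their entries. -/
instance matrixMeasurableSpace {m n α : Type*} [MeasurableSpace α] : MeasurableSpace (Matrix m n α) :=
  inferInstanceAs (MeasurableSpace (m → n → α))

/-- The flat (Lebesgue) measure on the space of `M × N` matrices over `𝕜`: the product of the
Lebesgue measures of the entries (over `ℂ`, of their real and imaginary parts). -/
noncomputable def flatMeasure (𝕜 : Type*) [MeasureSpace 𝕜] (M N : ℕ) :
    Measure (Matrix (Fin M) (Fin N) 𝕜) :=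
  Measure.pi fun _ : Fin M => Measure.pi fun _ : Fin N => (volume : Measure 𝕜)

/-- The probability measure proportional to `μ` (for `μ` of finite nonzero total mass). -/
noncomputable def normalized {α : Type*} [MeasurableSpace α] (μ : Measure α) : Measure α :=
  (μ Set.univ)⁻¹ • μ

/-- The Gaussian distribution on `M × N` matrices, with density proportional to
`exp (-(β / 2) Tr Xᴴ X)` (`β = 1` for real matrices, `β = 2` for complex ones). -/
noncomputable def gaussianMatrix (𝕜 : Type*) [RCLike 𝕜] [MeasureSpace 𝕜] (β : ℝ) (M N : ℕ) :
    Measure (Matrix (Fin M) (Fin N) 𝕜) :=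
  normalized ((flatMeasure 𝕜 M N).withDensity fun X =>
    ENNReal.ofReal (Real.exp (-(β / 2) * RCLike.re (Xᴴ * X).trace)))

/-- The induced Ginibre distribution on `N × N` matrices with parameter `L`, with density
proportional to `(det Gᴴ G) ^ (β L / 2) exp (-(β / 2) Tr Gᴴ G)`. -/
noncomputable def inducedGinibre (𝕜 : Type*) [RCLike 𝕜] [MeasureSpace 𝕜] (β : ℝ) (N : ℕ) (L : ℝ) :
    Measure (Matrix (Fin N) (Fin N) 𝕜) :=
  normalized ((flatMeasure 𝕜 N N).withDensity fun G =>
    ENNReal.ofReal (RCLike.re (Gᴴ * G).det ^ (β / 2 * L) *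
      Real.exp (-(β / 2) * RCLike.re (Gᴴ * G).trace)))

/-- The random matrix `U` is Haar distributed on the unitary group over `𝕜` (the orthogonal group
if `𝕜 = ℝ`): its law is a Haar measure. -/
def IsHaarDistributed {𝕜 : Type*} [RCLike 𝕜] [MeasurableSpace 𝕜] {N : ℕ}
    {Ω : Type*} [MeasurableSpace Ω] (U : Ω → Matrix.unitaryGroup (Fin N) 𝕜) (P : Measure Ω) :
    Prop :=
  AEMeasurable U P ∧ (P.map U).IsHaarMeasure

end InducedGinibre

/-! No Jacobian or normalising constant is computed; the law is identified by its behaviour under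
right multiplication. Let `η` be the law of `U`, and let `μ` be the image of `η` times Lebesgue
measure under `(U, X) ↦ U (Xᴴ X)^(1/2)`. Since `Gᴴ G = Xᴴ X`, the Gaussian weight is a function of
`G`, so it can be removed before comparing measures and restored afterwards
(`map_polarProduct_prod_withDensity`).

For invertible `h`, the polar decomposition of `(Xᴴ X)^(1/2) h` shows that multiplying `G` by `h`
replaces `(U, X)` by `(U W, X h)`, with `W` unitary and independent of `U`
(`exists_unitary_sqrt_mul`). Right invariance of `η` absorbs `W`, and Lebesgue measure contributes
`|det h|^(-β M)`. The measure `det(Gᴴ G)^(β (M - N) / 2) |dG|` scales by the same factor. Both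
measures live on the invertible matrices, where uniqueness of Haar measure makes them proportional
(`exists_eq_smul_of_map_mul_right_matrix`). Total mass one fixes the constant. -/

namespace InducedGinibre

open scoped ENNReal ComplexOrder

/-! ### Uniqueness of (relatively) invariant measures on measurable groups -/

section UniquenessOfInvariantMeasures

variable {G : Type*} [Group G] [MeasurableSpace G] [MeasurableMul₂ G] [MeasurableInv G]

theorem exists_set_measure_ne_zero_ne_top {α : Type*} [MeasurableSpace α] (ν : Measure α)
    [SigmaFinite ν] (hν : ν ≠ 0) : ∃ s, ν s ≠ 0 ∧ ν s ≠ ∞ := by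
  by_contra! h
  refine hν (Measure.measure_univ_eq_zero.1 ?_)
  rw [← iUnion_spanningSets ν, measure_iUnion_null_iff]
  intro i
  by_contra h0
  exact (measure_spanningSets_lt_top ν i).ne (h _ h0)

/-- Only a measurable group structure enters, no topology; this suits the group of units, whose
σ-algebra is pulled back from the matrices. -/
theorem exists_eq_smul_of_isMulLeftInvariant (μ ν : Measure G) [SigmaFinite μ] [SigmaFinite ν]
    [μ.IsMulLeftInvariant] [ν.IsMulLeftInvariant] (hν : ν ≠ 0) : ∃ c : ℝ≥0∞, μ = c • ν := by
  obtain ⟨s, h0, h1⟩ := exists_set_measure_ne_zero_ne_top ν hν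
  exact ⟨_, measure_eq_div_smul μ ν h0 h1⟩

theorem exists_eq_smul_of_isMulRightInvariant (μ ν : Measure G) [SigmaFinite μ] [SigmaFinite ν]
    [μ.IsMulRightInvariant] [ν.IsMulRightInvariant] (hν : ν ≠ 0) : ∃ c : ℝ≥0∞, μ = c • ν := by
  have hinv : ν.inv ≠ 0 := by
    intro h
    apply hν
    rw [← Measure.inv_inv ν, h]
    simp [Measure.inv]
  have : SigmaFinite μ.inv := (MeasurableEquiv.inv G).sigmaFinite_map
  have : SigmaFinite ν.inv := (MeasurableEquiv.inv G).sigmaFinite_map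
  obtain ⟨c, hc⟩ := exists_eq_smul_of_isMulLeftInvariant μ.inv ν.inv hinv
  refine ⟨c, ?_⟩
  rw [← Measure.inv_inv μ, hc, Measure.inv, Measure.map_smul, ← Measure.inv, Measure.inv_inv]

/-- On a measurable group, a left-invariant probability measure is right-invariant. -/
theorem isMulRightInvariant_of_isMulLeftInvariant (μ : Measure G) [IsProbabilityMeasure μ]
    [μ.IsMulLeftInvariant] : μ.IsMulRightInvariant := by
  refine ⟨fun g => ?_⟩
  have : IsProbabilityMeasure (μ.map (· * g)) :=
    Measure.isProbabilityMeasure_map (measurable_mul_const g).aemeasurable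
  -- Left and right translations commute, so a right translate stays left-invariant; uniqueness and
  -- equal total mass then identify it with `μ`.
  have : (μ.map (· * g)).IsMulLeftInvariant := by
    refine ⟨fun h => ?_⟩
    rw [Measure.map_map (measurable_const_mul h) (measurable_mul_const g)]
    conv_rhs => rw [← map_mul_left_eq_self μ h,
      Measure.map_map (measurable_mul_const g) (measurable_const_mul h)]
    congr 1
    ext x
    simp [mul_assoc]
  have := measure_eq_div_smul (s := Set.univ) (μ.map (· * g)) μ (by simp) (by simp)
  simpa using this

/-- Two σ-finite measures on a group which right translations scale by the same
character are proportional. -/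
theorem exists_eq_smul_of_map_mul_right (μ ν : Measure G) [SigmaFinite μ] [SigmaFinite ν]
    (hν : ν ≠ 0) (χ : G → ℝ≥0∞) (hχ : Measurable χ) (hmul : ∀ g h, χ (g * h) = χ g * χ h)
    (h0 : ∀ g, χ g ≠ 0) (htop : ∀ g, χ g ≠ ∞)
    (hμ' : ∀ h, μ.map (· * h) = (χ h)⁻¹ • μ) (hν' : ∀ h, ν.map (· * h) = (χ h)⁻¹ • ν) :
    ∃ c : ℝ≥0∞, μ = c • ν := by
  -- Dividing by the character turns relative invariance into genuine right invariance; `back`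
  -- undoes the division.
  have key : ∀ ρ : Measure G, (∀ h, ρ.map (· * h) = (χ h)⁻¹ • ρ) →
      (ρ.withDensity fun g => (χ g)⁻¹).IsMulRightInvariant := by
    intro ρ hρ
    refine ⟨fun h => ?_⟩
    refine Measure.ext_of_lintegral _ fun f hf => ?_
    have hm : Measurable fun g : G => g * h := measurable_mul_const h
    rw [lintegral_map hf hm, lintegral_withDensity_eq_lintegral_mul ρ (f := fun g => (χ g)⁻¹) hχ.inv
        (g := fun a => f (a * h)) (hf.comp hm),
      lintegral_withDensity_eq_lintegral_mul ρ (f := fun g => (χ g)⁻¹) hχ.inv hf]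
    have e : ∀ g, ((fun g => (χ g)⁻¹) * fun a => f (a * h)) g
        = χ h * ((χ (g * h))⁻¹ * f (g * h)) := by
      intro g
      simp only [Pi.mul_apply]
      rw [hmul, ENNReal.mul_inv (Or.inl (h0 g)) (Or.inl (htop g)), ← mul_assoc, ← mul_assoc,
        mul_comm (χ h), mul_assoc (χ g)⁻¹, ENNReal.mul_inv_cancel (h0 h) (htop h), mul_one]
    rw [lintegral_congr e, lintegral_const_mul _ (by fun_prop)]
    have := lintegral_map (μ := ρ) (f := fun g => (χ g)⁻¹ * f g) (by fun_prop) hm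
    rw [← this, hρ, lintegral_smul_measure, smul_eq_mul, ← mul_assoc,
      ENNReal.mul_inv_cancel (h0 h) (htop h), one_mul]
    rfl
  have := key μ hμ'
  have := key ν hν'
  have hinv : ∀ g, (χ g)⁻¹ ≠ ∞ := fun g => ENNReal.inv_ne_top.2 (h0 g)
  have hinv0 : ∀ g, (χ g)⁻¹ ≠ 0 := fun g => ENNReal.inv_ne_zero.2 (htop g)
  have : SigmaFinite (μ.withDensity fun g => (χ g)⁻¹) :=
    SigmaFinite.withDensity_of_ne_top (ae_of_all _ hinv)
  have : SigmaFinite (ν.withDensity fun g => (χ g)⁻¹) :=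
    SigmaFinite.withDensity_of_ne_top (ae_of_all _ hinv)
  have back : ∀ ρ : Measure G,
      ((ρ.withDensity fun g => (χ g)⁻¹).withDensity fun g => ((χ g)⁻¹)⁻¹) = ρ := fun ρ =>
    withDensity_inv_same hχ.inv (ae_of_all _ hinv0) (ae_of_all _ hinv)
  obtain ⟨c, hc⟩ := exists_eq_smul_of_isMulRightInvariant (μ.withDensity fun g => (χ g)⁻¹)
    (ν.withDensity fun g => (χ g)⁻¹) (fun h => hν (by rw [← back ν, h]; simp))
  exact ⟨c, by rw [← back μ, hc, withDensity_smul_measure, back]⟩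

end UniquenessOfInvariantMeasures

/-! ### Measurability of the group operations and of the matrix square root -/

section Measurability

variable {𝕜 : Type*} [RCLike 𝕜] [MeasurableSpace 𝕜] [BorelSpace 𝕜]

instance {m n : Type*} [Finite m] [Finite n] : BorelSpace (Matrix m n 𝕜) :=
  haveI := Fintype.ofFinite m
  haveI := Fintype.ofFinite n
  inferInstanceAs (BorelSpace (m → n → 𝕜))

instance {m n : Type*} [Finite m] [Finite n] : SecondCountableTopology (Matrix m n 𝕜) :=
  inferInstanceAs (SecondCountableTopology (m → n → 𝕜))

instance {m n : Type*} [Finite m] [Finite n] : PolishSpace (Matrix m n 𝕜) :=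
  inferInstanceAs (PolishSpace (m → n → 𝕜))

variable {n : Type*} [Fintype n] [DecidableEq n]

instance : MeasurableMul₂ (Matrix n n 𝕜) where
  measurable_mul := (by fun_prop : Continuous fun p : Matrix n n 𝕜 × Matrix n n 𝕜 =>
    p.1 * p.2).measurable

instance : MeasurableMul₂ (Matrix n n 𝕜)ˣ where
  measurable_mul := measurable_comap_iff.2 <|
    Measurable.mul (comap_measurable Units.val |>.comp measurable_fst)
      (comap_measurable Units.val |>.comp measurable_snd)

theorem measurable_matrix_inv : Measurable fun A : Matrix n n 𝕜 => A⁻¹ := by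
  simp only [Matrix.inv_def, Ring.inverse_eq_inv']
  have h1 : Measurable fun A : Matrix n n 𝕜 => A.det⁻¹ :=
    (by fun_prop : Continuous fun A : Matrix n n 𝕜 => A.det).measurable.inv
  refine measurable_pi_lambda _ fun i => measurable_pi_lambda _ fun j => h1.mul ?_
  exact (by fun_prop : Continuous fun A : Matrix n n 𝕜 => A.adjugate i j).measurable

instance : MeasurableInv (Matrix n n 𝕜)ˣ where
  measurable_inv := measurable_comap_iff.2 <| by
    have : (Units.val ∘ fun a : (Matrix n n 𝕜)ˣ => a⁻¹) = (fun A => A⁻¹) ∘ Units.val := by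
      ext1 a
      simp [Matrix.coe_units_inv]
    rw [this]
    exact measurable_matrix_inv.comp (comap_measurable Units.val)

instance : MeasurableMul₂ (Matrix.unitaryGroup n 𝕜) where
  measurable_mul := Measurable.subtype_mk <|
    (measurable_subtype_coe.comp measurable_fst).mul (measurable_subtype_coe.comp measurable_snd)

instance : MeasurableInv (Matrix.unitaryGroup n 𝕜) where
  measurable_inv := Measurable.subtype_mk <|
    (by fun_prop : Continuous fun A : Matrix n n 𝕜 => star A).measurable.comp measurable_subtype_coe

/-- The positive semidefinite square root of `Xᴴ X` depends measurably on `X`. -/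
theorem measurable_sqrt_conjTranspose_mul_self {m : Type*} [Fintype m] :
    Measurable fun X : Matrix m n 𝕜 => CFC.sqrt (Xᴴ * X) := by
  have hcl : IsClosed {A : Matrix n n 𝕜 | 0 ≤ A} := by
    have : {A : Matrix n n 𝕜 | 0 ≤ A} =
        {A | Aᴴ = A} ∩ ⋂ x : n → 𝕜, {A | 0 ≤ star x ⬝ᵥ (A *ᵥ x)} := by
      ext A
      simp only [Set.mem_ofPred_eq, Matrix.nonneg_iff_posSemidef, Set.mem_inter_iff, Set.mem_iInter,
        Matrix.posSemidef_iff_dotProduct_mulVec, Matrix.IsHermitian]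
    rw [this]
    refine (isClosed_eq (by fun_prop) (by fun_prop)).inter (isClosed_iInter fun x => ?_)
    exact isClosed_le (by fun_prop) (by fun_prop)
  have : PolishSpace {A : Matrix n n 𝕜 | 0 ≤ A} := hcl.polishSpace
  -- Lusin–Souslin: squaring is continuous and injective on the Polish cone of positive semidefinite
  -- matrices, so its inverse, the square root, is measurable.
  have hemb : MeasurableEmbedding fun A : {A : Matrix n n 𝕜 | 0 ≤ A} => (A : Matrix n n 𝕜) * A :=
    Continuous.measurableEmbedding (by fun_prop) fun A B h => Subtype.ext <| by
      rw [← CFC.sqrt_mul_self (A : Matrix n n 𝕜) A.2, ← CFC.sqrt_mul_self (B : Matrix n n 𝕜) B.2]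
      exact congrArg CFC.sqrt h
  have hmeas : Measurable fun X : Matrix m n 𝕜 =>
      (⟨CFC.sqrt (Xᴴ * X), CFC.sqrt_nonneg (Xᴴ * X)⟩ : {A : Matrix n n 𝕜 | 0 ≤ A}) := by
    rw [← hemb.measurable_comp_iff]
    have : ((fun A : {A : Matrix n n 𝕜 | 0 ≤ A} => (A : Matrix n n 𝕜) * A) ∘
        fun X : Matrix m n 𝕜 => ⟨CFC.sqrt (Xᴴ * X), CFC.sqrt_nonneg (Xᴴ * X)⟩) = fun X => Xᴴ * X := by
      ext1 X
      exact CFC.sqrt_mul_sqrt_self _ (Matrix.posSemidef_conjTranspose_mul_self X).nonneg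
    rw [this]
    exact (by fun_prop : Continuous fun X : Matrix m n 𝕜 => Xᴴ * X).measurable
  exact measurable_subtype_coe.comp hmeas

end Measurability

/-! ### Transfer of uniqueness from the unit group to all square matrices -/

section UniquenessOnMatrices

variable {𝕜 : Type*} [RCLike 𝕜] {n : Type*} [Fintype n] [DecidableEq n]

open Classical in
/-- The retraction of all square matrices onto the invertible ones which sends the singular
matrices to `1`. -/
noncomputable def toUnits (A : Matrix n n 𝕜) : (Matrix n n 𝕜)ˣ :=
  if h : IsUnit A then h.unit else 1

theorem val_toUnits {A : Matrix n n 𝕜} (h : IsUnit A) : (toUnits A : Matrix n n 𝕜) = A := by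
  simp [toUnits, h]

theorem toUnits_mul {A : Matrix n n 𝕜} (h : IsUnit A) (B : (Matrix n n 𝕜)ˣ) :
    toUnits (A * (B : Matrix n n 𝕜)) = toUnits A * B := by
  ext1
  rw [val_toUnits (h.mul B.isUnit), Units.val_mul, val_toUnits h]

theorem measurable_unitsVal [MeasurableSpace 𝕜] :
    Measurable (Units.val : (Matrix n n 𝕜)ˣ → Matrix n n 𝕜) :=
  comap_measurable _

variable [MeasurableSpace 𝕜] [BorelSpace 𝕜]

theorem measurableSet_isUnit : MeasurableSet {A : Matrix n n 𝕜 | IsUnit A} := by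
  simp only [Matrix.isUnit_iff_isUnit_det, isUnit_iff_ne_zero]
  exact (by fun_prop : Continuous fun A : Matrix n n 𝕜 => A.det).measurable
    (measurableSet_singleton 0).compl

theorem measurable_toUnits : Measurable (toUnits : Matrix n n 𝕜 → _) := by
  classical
  refine measurable_comap_iff.2 ?_
  have : Units.val ∘ (toUnits : Matrix n n 𝕜 → _) = fun A => if IsUnit A then A else 1 := by
    ext1 A
    by_cases h : IsUnit A <;> simp [toUnits, h]
  rw [this]
  exact Measurable.ite measurableSet_isUnit measurable_id measurable_const

theorem map_val_map_toUnits {μ : Measure (Matrix n n 𝕜)} (h : ∀ᵐ A ∂μ, IsUnit A) :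
    (μ.map toUnits).map Units.val = μ := by
  rw [Measure.map_map measurable_unitsVal measurable_toUnits]
  conv_rhs => rw [← Measure.map_id (μ := μ)]
  refine Measure.map_congr ?_
  filter_upwards [h] with A hA
  exact val_toUnits hA

theorem sigmaFinite_map_toUnits {μ : Measure (Matrix n n 𝕜)} [SigmaFinite μ]
    (h : ∀ᵐ A ∂μ, IsUnit A) : SigmaFinite (μ.map toUnits) := by
  refine SigmaFinite.of_map _ measurable_unitsVal.aemeasurable ?_
  rwa [map_val_map_toUnits h]

/-- Two σ-finite measures concentrated on invertible matrices which right multiplications scale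
by the same character are proportional. -/
theorem exists_eq_smul_of_map_mul_right_matrix (μ ν : Measure (Matrix n n 𝕜)) [SigmaFinite μ]
    [SigmaFinite ν] (hμ : ∀ᵐ A ∂μ, IsUnit A) (hν : ∀ᵐ A ∂ν, IsUnit A) (hν0 : ν ≠ 0)
    (χ : Matrix n n 𝕜 → ℝ≥0∞) (hχ : Measurable χ) (hmul : ∀ A B, χ (A * B) = χ A * χ B)
    (h0 : ∀ A, IsUnit A → χ A ≠ 0) (htop : ∀ A, χ A ≠ ∞)
    (hμ' : ∀ h, IsUnit h → μ.map (· * h) = (χ h)⁻¹ • μ)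
    (hν' : ∀ h, IsUnit h → ν.map (· * h) = (χ h)⁻¹ • ν) :
    ∃ c : ℝ≥0∞, μ = c • ν := by
  have := sigmaFinite_map_toUnits hμ
  have := sigmaFinite_map_toUnits hν
  have key : ∀ ρ : Measure (Matrix n n 𝕜), (∀ᵐ A ∂ρ, IsUnit A) →
      (∀ h, IsUnit h → ρ.map (· * h) = (χ h)⁻¹ • ρ) → ∀ h : (Matrix n n 𝕜)ˣ,
      (ρ.map toUnits).map (· * h) = (χ h)⁻¹ • ρ.map toUnits := by
    intro ρ hu hρ h
    rw [Measure.map_map (measurable_mul_const h) measurable_toUnits, ← Measure.map_smul,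
      ← hρ _ h.isUnit, Measure.map_map measurable_toUnits (measurable_mul_const _)]
    refine Measure.map_congr ?_
    filter_upwards [hu] with A hA
    exact (toUnits_mul hA h).symm
  obtain ⟨c, hc⟩ := exists_eq_smul_of_map_mul_right (μ.map toUnits) (ν.map toUnits)
    (fun h => hν0 (by rw [← map_val_map_toUnits hν, h, Measure.map_zero]))
    (fun g => χ g) (hχ.comp measurable_unitsVal) (fun g h => by simp [hmul])
    (fun g => h0 _ g.isUnit) (fun g => htop _) (key μ hμ hμ') (key ν hν hν')
  exact ⟨c, by rw [← map_val_map_toUnits hμ, hc, Measure.map_smul, map_val_map_toUnits hν]⟩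

end UniquenessOnMatrices

/-! ### Lebesgue measure: scaling and null sets -/

section FlatMeasure

theorem det_conjTranspose_mul_self_ne_zero {𝕜 : Type*} [RCLike 𝕜] {m n : Type*}
    [Fintype m] [Fintype n] [DecidableEq n] (e : n → m) (X : Matrix m n 𝕜)
    (h : (X.submatrix e id).det ≠ 0) : (Xᴴ * X).det ≠ 0 := by
  contrapose! h
  obtain ⟨v, hv, hXv⟩ := Matrix.exists_mulVec_eq_zero_iff.2 h
  refine Matrix.exists_mulVec_eq_zero_iff.1 ⟨v, hv, ?_⟩
  have := (Matrix.conjTranspose_mul_self_mulVec_eq_zero X v).1 hXv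
  ext i
  exact congrFun this (e i)

variable {𝕜 : Type*} [RCLike 𝕜] [MeasureSpace 𝕜] [BorelSpace 𝕜]
  [(volume : Measure 𝕜).IsAddHaarMeasure] {M N : ℕ}

instance : SigmaFinite (flatMeasure 𝕜 M N) := by
  have h : ∀ ρ : Measure (Fin N → 𝕜), SigmaFinite ρ →
      SigmaFinite (Measure.pi fun _ : Fin M => ρ) := fun _ _ => inferInstance
  exact h _ inferInstance

instance : (flatMeasure 𝕜 M N).IsAddLeftInvariant := by
  have h : ∀ ρ : Measure (Fin N → 𝕜), SigmaFinite ρ → ρ.IsAddLeftInvariant →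
      (Measure.pi fun _ : Fin M => ρ).IsAddLeftInvariant := fun _ _ _ => inferInstance
  exact h _ inferInstance inferInstance

theorem flatMeasure_ne_zero : flatMeasure 𝕜 M N ≠ 0 := by
  rw [← Measure.measure_univ_ne_zero]
  have : flatMeasure 𝕜 M N Set.univ = ∏ _i : Fin M, ∏ _j : Fin N, volume (Set.univ : Set 𝕜) :=
    (Measure.pi_univ _).trans (by simp only [Measure.pi_univ])
  rw [this]
  simp

/-- Right multiplication by an invertible matrix scales the flat measure by a power of the
determinant. -/
theorem map_mul_right_flatMeasure {β : ℝ} (hβ : ∀ z : 𝕜, |Algebra.norm ℝ z| = ‖z‖ ^ β)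
    (h : Matrix (Fin N) (Fin N) 𝕜) (hh : IsUnit h) :
    (flatMeasure 𝕜 M N).map (· * h) = (ENNReal.ofReal (‖h.det‖ ^ β) ^ M)⁻¹ • flatMeasure 𝕜 M N := by
  set row : Measure (Fin N → 𝕜) := Measure.pi fun _ : Fin N => (volume : Measure 𝕜) with hrow
  have hdet : h.det ≠ 0 := (Matrix.isUnit_iff_isUnit_det h).1 hh |>.ne_zero
  have hpos : 0 < ‖h.det‖ ^ β := Real.rpow_pos_of_pos (norm_pos_iff.2 hdet) β
  -- The Jacobian on each row is the determinant over `ℝ`, that is, the field norm of `h.det`. The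
  -- `M` rows give the power `M`.
  let f : (Fin N → 𝕜) →ₗ[ℝ] (Fin N → 𝕜) := (Matrix.toLin' hᵀ).restrictScalars ℝ
  have hf : |LinearMap.det f| = ‖h.det‖ ^ β := by
    rw [LinearMap.det_restrictScalars, LinearMap.det_toLin', Matrix.det_transpose, hβ]
  have hmap : row.map (fun x => x ᵥ* h) = (ENNReal.ofReal (‖h.det‖ ^ β))⁻¹ • row := by
    have h1 : (fun x : Fin N → 𝕜 => x ᵥ* h) = f := by
      ext1 x
      simp [f, Matrix.mulVec_transpose]
    rw [h1, Measure.map_linearMap_addHaar_eq_smul_addHaar row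
      (abs_pos.1 (hf ▸ hpos)), abs_inv, hf, ENNReal.ofReal_inv_of_pos hpos]
  have hc0 : (ENNReal.ofReal (‖h.det‖ ^ β))⁻¹ ≠ 0 := ENNReal.inv_ne_zero.2 ENNReal.ofReal_ne_top
  have hctop : (ENNReal.ofReal (‖h.det‖ ^ β))⁻¹ ≠ ∞ :=
    ENNReal.inv_ne_top.2 (ENNReal.ofReal_pos.2 hpos).ne'
  have hhaar := Measure.IsAddHaarMeasure.smul row hc0 hctop
  have hsf : SigmaFinite (row.map fun x => x ᵥ* h) := by
    rw [hmap]
    infer_instance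
  have hmeas : Measurable fun x : Fin N → 𝕜 => x ᵥ* h :=
    (by fun_prop : Continuous fun x : Fin N → 𝕜 => x ᵥ* h).measurable
  have hpi : (Measure.pi fun _ : Fin M => row).map (fun X i => X i ᵥ* h) =
      Measure.pi fun _ : Fin M => row.map fun x => x ᵥ* h :=
    Measure.pi_map_pi (μ := fun _ : Fin M => row) (f := fun _ x => x ᵥ* h) (hμ := fun _ => hsf)
      fun _ => hmeas.aemeasurable
  refine Eq.trans hpi ?_
  refine Measure.pi_eq fun s _ => ?_
  rw [hmap]
  simp only [Measure.smul_apply, smul_eq_mul, flatMeasure]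
  rw [Finset.prod_mul_distrib, Finset.prod_const, Finset.card_univ, Fintype.card_fin,
    ENNReal.inv_pow]
  exact (Measure.smul_apply _ (Measure.pi fun _ : Fin M => row) _).trans
    (congrArg ((ENNReal.ofReal (‖h.det‖ ^ β))⁻¹ ^ M * ·) (Measure.pi_pi (fun _ => row) s))

/-- The matrices with a singular top square block form a null set. -/
theorem flatMeasure_det_submatrix_eq_zero (hMN : N ≤ M) :
    flatMeasure 𝕜 M N {X | (X.submatrix (Fin.castLE hMN) id).det = 0} = 0 := by
  set S : Set (Matrix (Fin M) (Fin N) 𝕜) := {X | (X.submatrix (Fin.castLE hMN) id).det = 0}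
  -- Along the line `t • E + X` the determinant of the top block is a monic characteristic
  -- polynomial in `t`, with finitely many roots. Fubini and translation invariance conclude.
  let E : Matrix (Fin M) (Fin N) 𝕜 := Matrix.of fun i j => if i = Fin.castLE hMN j then 1 else 0
  have hE : ∀ (t : 𝕜) (X : Matrix (Fin M) (Fin N) 𝕜),
      ((t • E + X).submatrix (Fin.castLE hMN) id).det =
        (-(X.submatrix (Fin.castLE hMN) id)).charpoly.eval t := by
    intro t X
    rw [Matrix.eval_charpoly]
    congr 1
    ext i j
    by_cases hij : i = j <;> simp [E, hij, Matrix.diagonal]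
  have hSm : MeasurableSet S :=
    (by fun_prop : Continuous fun X : Matrix (Fin M) (Fin N) 𝕜 =>
      (X.submatrix (Fin.castLE hMN) id).det).measurable (measurableSet_singleton 0)
  let T : Set (𝕜 × Matrix (Fin M) (Fin N) 𝕜) := {p | p.1 • E + p.2 ∈ S}
  have hTm : MeasurableSet T :=
    (by fun_prop : Continuous fun p : 𝕜 × Matrix (Fin M) (Fin N) 𝕜 =>
      p.1 • E + p.2).measurable hSm
  have h1 : ((volume : Measure 𝕜).prod (flatMeasure 𝕜 M N)) T = flatMeasure 𝕜 M N S * volume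
      (Set.univ : Set 𝕜) := by
    rw [Measure.prod_apply hTm, ← lintegral_const]
    refine lintegral_congr fun t => ?_
    exact measure_preimage_add (flatMeasure 𝕜 M N) (t • E) S
  have h2 : ((volume : Measure 𝕜).prod (flatMeasure 𝕜 M N)) T = 0 := by
    rw [Measure.prod_apply_symm hTm]
    refine lintegral_eq_zero_of_ae_eq_zero (ae_of_all _ fun X => ?_)
    refine (Set.Finite.subset (s := {t | (-(X.submatrix (Fin.castLE hMN) id)).charpoly.IsRoot t})
      (Polynomial.finite_setOfPred_isRoot (Matrix.charpoly_monic _).ne_zero) ?_).measure_zero _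
    intro t ht
    exact (hE t X).symm.trans ht
  rw [h1] at h2
  exact (mul_eq_zero.1 h2).resolve_right (by simp)

theorem ae_isUnit_conjTranspose_mul_self (hMN : N ≤ M) :
    ∀ᵐ X ∂(flatMeasure 𝕜 M N), IsUnit (Xᴴ * X) := by
  have : ∀ᵐ X ∂(flatMeasure 𝕜 M N), ¬ (X.submatrix (Fin.castLE hMN) id).det = 0 := by
    rw [ae_iff]
    simpa using flatMeasure_det_submatrix_eq_zero (𝕜 := 𝕜) hMN
  filter_upwards [this] with X hX
  exact (Matrix.isUnit_iff_isUnit_det _).2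
    (isUnit_iff_ne_zero.2 (det_conjTranspose_mul_self_ne_zero _ X hX))

theorem ae_isUnit_flatMeasure : ∀ᵐ G ∂(flatMeasure 𝕜 N N), IsUnit G := by
  filter_upwards [ae_isUnit_conjTranspose_mul_self (𝕜 := 𝕜) (le_refl N)] with G hG
  exact isUnit_of_mul_isUnit_right hG

end FlatMeasure

/-! ### Polar decomposition -/

section Polar

variable {𝕜 : Type*} [RCLike 𝕜] {m n : Type*} [Fintype m] [Fintype n] [DecidableEq n]

/-- The matrix `U (Xᴴ X)^(1/2)` built from a unitary `U` and a rectangular matrix `X`. -/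
noncomputable def polarProduct (p : Matrix.unitaryGroup n 𝕜 × Matrix m n 𝕜) : Matrix n n 𝕜 :=
  (p.1 : Matrix n n 𝕜) * CFC.sqrt (p.2ᴴ * p.2)

theorem sqrt_mul_sqrt (X : Matrix m n 𝕜) :
    CFC.sqrt (Xᴴ * X) * CFC.sqrt (Xᴴ * X) = Xᴴ * X :=
  CFC.sqrt_mul_sqrt_self _ (Matrix.posSemidef_conjTranspose_mul_self X).nonneg

theorem conjTranspose_sqrt (A : Matrix n n 𝕜) : (CFC.sqrt A)ᴴ = CFC.sqrt A :=
  (CFC.sqrt_nonneg A).isSelfAdjoint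

theorem conjTranspose_polarProduct_mul_self (p : Matrix.unitaryGroup n 𝕜 × Matrix m n 𝕜) :
    (polarProduct p)ᴴ * polarProduct p = p.2ᴴ * p.2 := by
  have hU : (p.1 : Matrix n n 𝕜)ᴴ * p.1 = 1 := Matrix.UnitaryGroup.star_mul_self p.1
  rw [polarProduct, Matrix.conjTranspose_mul, conjTranspose_sqrt, Matrix.mul_assoc,
    ← Matrix.mul_assoc _ _ (CFC.sqrt _), hU, Matrix.one_mul, sqrt_mul_sqrt]

theorem isUnit_polarProduct {p : Matrix.unitaryGroup n 𝕜 × Matrix m n 𝕜}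
    (h : IsUnit (p.2ᴴ * p.2)) : IsUnit (polarProduct p) := by
  rw [← conjTranspose_polarProduct_mul_self] at h
  exact isUnit_of_mul_isUnit_right h

/-- Polar decomposition of an invertible matrix. -/
theorem exists_eq_unitary_mul_sqrt {A : Matrix n n 𝕜} (hA : IsUnit A) :
    ∃ W : Matrix.unitaryGroup n 𝕜, A = W * CFC.sqrt (Aᴴ * A) := by
  set S := CFC.sqrt (Aᴴ * A) with hS
  have hSS : S * S = Aᴴ * A := sqrt_mul_sqrt A
  have hSH : Sᴴ = S := conjTranspose_sqrt _
  have hSu : IsUnit S := by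
    have : IsUnit (S * S) := by
      rw [hSS]
      exact ((Matrix.isUnit_conjTranspose A).2 hA).mul hA
    exact isUnit_of_mul_isUnit_right this
  have hdet : IsUnit S.det := (Matrix.isUnit_iff_isUnit_det S).1 hSu
  refine ⟨⟨A * S⁻¹, Matrix.mem_unitaryGroup_iff'.2 ?_⟩, ?_⟩
  · rw [Matrix.star_eq_conjTranspose, Matrix.conjTranspose_mul, Matrix.conjTranspose_nonsing_inv,
      hSH, Matrix.mul_assoc, ← Matrix.mul_assoc Aᴴ, ← hSS, Matrix.mul_assoc S,
      Matrix.mul_nonsing_inv _ hdet, Matrix.mul_one, Matrix.nonsing_inv_mul _ hdet]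
  · change A = A * S⁻¹ * S
    rw [Matrix.mul_assoc, Matrix.nonsing_inv_mul _ hdet, Matrix.mul_one]

theorem exists_unitary_sqrt_mul {X : Matrix m n 𝕜} (hX : IsUnit (Xᴴ * X)) {h : Matrix n n 𝕜}
    (hh : IsUnit h) : ∃ W : Matrix.unitaryGroup n 𝕜, ∀ U : Matrix.unitaryGroup n 𝕜,
      polarProduct (U, X) * h = polarProduct (U * W, X * h) := by
  have hu : IsUnit (CFC.sqrt (Xᴴ * X)) := by
    rw [← sqrt_mul_sqrt] at hX
    exact isUnit_of_mul_isUnit_right hX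
  obtain ⟨W, hW⟩ := exists_eq_unitary_mul_sqrt (hu.mul hh)
  refine ⟨W, fun U => ?_⟩
  have e : (CFC.sqrt (Xᴴ * X) * h)ᴴ * (CFC.sqrt (Xᴴ * X) * h) = (X * h)ᴴ * (X * h) := by
    rw [Matrix.conjTranspose_mul, conjTranspose_sqrt, Matrix.mul_assoc,
      ← Matrix.mul_assoc _ _ h, sqrt_mul_sqrt, Matrix.conjTranspose_mul]
    simp only [Matrix.mul_assoc]
  rw [e] at hW
  simp only [polarProduct, Submonoid.coe_mul]
  rw [Matrix.mul_assoc, hW, ← Matrix.mul_assoc]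

theorem measurable_polarProduct [MeasurableSpace 𝕜] [BorelSpace 𝕜] :
    Measurable (polarProduct : Matrix.unitaryGroup n 𝕜 × Matrix m n 𝕜 → Matrix n n 𝕜) :=
  (measurable_subtype_coe.comp measurable_fst).mul
    (measurable_sqrt_conjTranspose_mul_self.comp measurable_snd)

theorem re_det_conjTranspose_mul_self (A : Matrix n n 𝕜) :
    RCLike.re (Aᴴ * A).det = ‖A.det‖ ^ 2 := by
  rw [Matrix.det_mul, Matrix.det_conjTranspose, RCLike.star_def, RCLike.conj_mul,
    ← RCLike.ofReal_pow, RCLike.ofReal_re]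

end Polar

/-! ### Gaussian and determinantal weights -/

section Weights

variable {𝕜 : Type*} [RCLike 𝕜]

/-- The Gaussian weight of a matrix. -/
noncomputable def gaussianWeight (β : ℝ) {M N : ℕ} (X : Matrix (Fin M) (Fin N) 𝕜) : ℝ≥0∞ :=
  ENNReal.ofReal (Real.exp (-(β / 2) * RCLike.re (Xᴴ * X).trace))

/-- The determinantal weight of a square matrix. -/
noncomputable def detWeight (p : ℝ) {N : ℕ} (G : Matrix (Fin N) (Fin N) 𝕜) : ℝ≥0∞ :=
  ENNReal.ofReal (RCLike.re (Gᴴ * G).det ^ p)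

theorem detWeight_mul (p : ℝ) {N : ℕ} (G h : Matrix (Fin N) (Fin N) 𝕜) :
    detWeight p (G * h) = detWeight p G * detWeight p h := by
  simp only [detWeight, re_det_conjTranspose_mul_self]
  rw [← ENNReal.ofReal_mul (by positivity), ← Real.mul_rpow (by positivity) (by positivity),
    Matrix.det_mul, norm_mul, mul_pow]

theorem detWeight_ne_zero (p : ℝ) {N : ℕ} {h : Matrix (Fin N) (Fin N) 𝕜} (hh : IsUnit h) :
    detWeight p h ≠ 0 := by
  have : h.det ≠ 0 := ((Matrix.isUnit_iff_isUnit_det h).1 hh).ne_zero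
  simp only [detWeight, re_det_conjTranspose_mul_self]
  exact (ENNReal.ofReal_pos.2 (by positivity)).ne'

theorem gaussianMatrix_eq [MeasureSpace 𝕜] {M N : ℕ} (β : ℝ) : gaussianMatrix 𝕜 β M N =
    (((flatMeasure 𝕜 M N).withDensity (gaussianWeight β)) Set.univ)⁻¹ •
      (flatMeasure 𝕜 M N).withDensity (gaussianWeight β) := rfl

end Weights

/-! ### Identification of the law -/

section Laws

variable {𝕜 : Type*} [RCLike 𝕜] [MeasureSpace 𝕜] [BorelSpace 𝕜]

variable {M N : ℕ}

theorem measurable_gaussianWeight (β : ℝ) :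
    Measurable (gaussianWeight β : Matrix (Fin M) (Fin N) 𝕜 → ℝ≥0∞) :=
  ENNReal.measurable_ofReal.comp (by fun_prop : Continuous fun X : Matrix (Fin M) (Fin N) 𝕜 =>
    Real.exp (-(β / 2) * RCLike.re (Xᴴ * X).trace)).measurable

theorem measurable_detWeight (p : ℝ) :
    Measurable (detWeight p : Matrix (Fin N) (Fin N) 𝕜 → ℝ≥0∞) :=
  ENNReal.measurable_ofReal.comp (Measurable.pow_const
    (by fun_prop : Continuous fun X : Matrix (Fin N) (Fin N) 𝕜 =>
      RCLike.re (Xᴴ * X).det).measurable p)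

variable [(volume : Measure 𝕜).IsAddHaarMeasure]

theorem map_mul_right_flatMeasure_withDensity {β : ℝ}
    (hβ : ∀ z : 𝕜, |Algebra.norm ℝ z| = ‖z‖ ^ β)
    (h : Matrix (Fin N) (Fin N) 𝕜) (hh : IsUnit h) :
    ((flatMeasure 𝕜 N N).withDensity (detWeight (β / 2 * ((M : ℝ) - N)))).map (· * h) =
      (ENNReal.ofReal (‖h.det‖ ^ β) ^ M)⁻¹ •
        (flatMeasure 𝕜 N N).withDensity (detWeight (β / 2 * ((M : ℝ) - N))) := by
  set p := β / 2 * ((M : ℝ) - N) with hp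
  have hm : Measurable fun G : Matrix (Fin N) (Fin N) 𝕜 => G * h := measurable_mul_const h
  have hD := measurable_detWeight (𝕜 := 𝕜) (N := N) p
  have hD0 := detWeight_ne_zero p hh
  have hDtop : detWeight p h ≠ ∞ := ENNReal.ofReal_ne_top
  have hdet : 0 < ‖h.det‖ := norm_pos_iff.2 ((Matrix.isUnit_iff_isUnit_det h).1 hh).ne_zero
  -- The exponents of `‖h.det‖` add up: `β (M - N)` from the weight and `β N` from Lebesgue measure.
  have hprod : detWeight p h * ENNReal.ofReal (‖h.det‖ ^ β) ^ N =
      ENNReal.ofReal (‖h.det‖ ^ β) ^ M := by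
    rw [detWeight, re_det_conjTranspose_mul_self, ← ENNReal.ofReal_pow (by positivity),
      ← ENNReal.ofReal_pow (by positivity), ← ENNReal.ofReal_mul (by positivity)]
    congr 1
    rw [← Real.rpow_natCast _ 2, ← Real.rpow_natCast _ N, ← Real.rpow_natCast _ M,
      ← Real.rpow_mul hdet.le, ← Real.rpow_mul hdet.le, ← Real.rpow_mul hdet.le,
      ← Real.rpow_add hdet, hp]
    congr 1
    push_cast
    ring
  refine Measure.ext_of_lintegral _ fun f hf => ?_
  rw [lintegral_map hf hm, lintegral_smul_measure, smul_eq_mul,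
    lintegral_withDensity_eq_lintegral_mul _ hD (g := fun G => f (G * h)) (hf.comp hm),
    lintegral_withDensity_eq_lintegral_mul _ hD hf]
  have e : ∀ G, (detWeight p * fun G => f (G * h) : Matrix (Fin N) (Fin N) 𝕜 → ℝ≥0∞) G =
      (detWeight p h)⁻¹ * (detWeight p * f : Matrix (Fin N) (Fin N) 𝕜 → ℝ≥0∞) (G * h) := by
    intro G
    simp only [Pi.mul_apply, detWeight_mul]
    rw [mul_comm (detWeight p G) (detWeight p h), mul_assoc, ← mul_assoc,
      ENNReal.inv_mul_cancel hD0 hDtop, one_mul]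
  rw [lintegral_congr e, lintegral_const_mul (detWeight p h)⁻¹
      (f := fun G => (detWeight p * f : Matrix (Fin N) (Fin N) 𝕜 → ℝ≥0∞) (G * h))
      ((hD.mul hf).comp hm),
    ← lintegral_map (hD.mul hf) hm, map_mul_right_flatMeasure hβ h hh, lintegral_smul_measure,
    smul_eq_mul, ← mul_assoc, ← hprod, ENNReal.mul_inv (Or.inl hD0) (Or.inl hDtop)]

/-- Integrating over `U` first, with `X` fixed, lets right invariance of `η` remove `W`, so no
measurable choice of `W` in terms of `X` is needed. -/
theorem map_mul_right_map_polarProduct {β : ℝ} (hβ : ∀ z : 𝕜, |Algebra.norm ℝ z| = ‖z‖ ^ β)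
    (hMN : N ≤ M) (η : Measure (Matrix.unitaryGroup (Fin N) 𝕜)) [SFinite η]
    [η.IsMulRightInvariant] (h : Matrix (Fin N) (Fin N) 𝕜) (hh : IsUnit h) :
    ((η.prod (flatMeasure 𝕜 M N)).map polarProduct).map (· * h) =
      (ENNReal.ofReal (‖h.det‖ ^ β) ^ M)⁻¹ • (η.prod (flatMeasure 𝕜 M N)).map polarProduct := by
  have hm : Measurable fun G : Matrix (Fin N) (Fin N) 𝕜 => G * h := measurable_mul_const h
  have hm' : Measurable fun X : Matrix (Fin M) (Fin N) 𝕜 => X * h :=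
    (by fun_prop : Continuous fun X : Matrix (Fin M) (Fin N) 𝕜 => X * h).measurable
  refine Measure.ext_of_lintegral _ fun f hf => ?_
  have hΦ : Measurable fun p : Matrix.unitaryGroup (Fin N) 𝕜 × Matrix (Fin M) (Fin N) 𝕜 =>
    f (polarProduct p) := hf.comp measurable_polarProduct
  have hF : Measurable fun X : Matrix (Fin M) (Fin N) 𝕜 => ∫⁻ U, f (polarProduct (U, X)) ∂η :=
    hΦ.lintegral_prod_left'
  rw [lintegral_map hf hm, lintegral_map (f := fun G => f (G * h)) (hf.comp hm) measurable_polarProduct,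
    lintegral_smul_measure, lintegral_map hf measurable_polarProduct,
    lintegral_prod_symm' (fun p => f (polarProduct p * h))
      (hf.comp hm |>.comp measurable_polarProduct),
    lintegral_prod_symm' _ hΦ, ← lintegral_smul_measure, ← map_mul_right_flatMeasure hβ h hh,
    lintegral_map hF hm']
  refine lintegral_congr_ae ?_
  filter_upwards [ae_isUnit_conjTranspose_mul_self (𝕜 := 𝕜) hMN] with X hX
  obtain ⟨W, hW⟩ := exists_unitary_sqrt_mul hX hh
  simp only [hW]
  exact lintegral_mul_right_eq_self (fun U => f (polarProduct (U, X * h))) W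

theorem map_polarProduct_prod_withDensity (β : ℝ)
    (η : Measure (Matrix.unitaryGroup (Fin N) 𝕜)) [SFinite η] :
    (η.prod ((flatMeasure 𝕜 M N).withDensity (gaussianWeight β))).map polarProduct =
      ((η.prod (flatMeasure 𝕜 M N)).map polarProduct).withDensity (gaussianWeight β) := by
  have hγ := measurable_gaussianWeight (𝕜 := 𝕜) (M := M) (N := N) β
  have hγ' := measurable_gaussianWeight (𝕜 := 𝕜) (M := N) (N := N) β
  rw [prod_withDensity_right hγ]
  refine Measure.ext_of_lintegral _ fun f hf => ?_
  rw [lintegral_map hf measurable_polarProduct,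
    lintegral_withDensity_eq_lintegral_mul _ (f := fun z : Matrix.unitaryGroup (Fin N) 𝕜 × Matrix (Fin M) (Fin N) 𝕜 =>
      gaussianWeight β z.2)
      (hγ.comp measurable_snd) (g := fun a => f (polarProduct a))
      (hf.comp measurable_polarProduct),
    lintegral_withDensity_eq_lintegral_mul _ hγ' hf,
    lintegral_map (hγ'.mul hf) measurable_polarProduct]
  refine lintegral_congr fun p => ?_
  simp only [Pi.mul_apply, gaussianWeight, conjTranspose_polarProduct_mul_self]

/-- The law of `U (Xᴴ X)^(1/2)` for `X` Gaussian and `U` uniform on the unitary group. -/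
theorem map_polarProduct_prod_gaussianMatrix {β : ℝ}
    (hβ : ∀ z : 𝕜, |Algebra.norm ℝ z| = ‖z‖ ^ β) (hMN : N ≤ M)
    (η : Measure (Matrix.unitaryGroup (Fin N) 𝕜)) [IsProbabilityMeasure η]
    [η.IsMulRightInvariant] [hgP : IsProbabilityMeasure (gaussianMatrix 𝕜 β M N)] :
    (η.prod (gaussianMatrix 𝕜 β M N)).map polarProduct = inducedGinibre 𝕜 β N ((M : ℝ) - N) := by
  have hlawP : IsProbabilityMeasure ((η.prod (gaussianMatrix 𝕜 β M N)).map polarProduct) :=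
    Measure.isProbabilityMeasure_map measurable_polarProduct.aemeasurable
  set γ₀ := (flatMeasure 𝕜 M N).withDensity (gaussianWeight β) with hγ₀
  have hg : gaussianMatrix 𝕜 β M N = (γ₀ Set.univ)⁻¹ • γ₀ := gaussianMatrix_eq β
  -- Infinite mass would make the normalised measure zero, contradicting `hgP`; no Gaussian integral
  -- is evaluated.
  have hZ : γ₀ Set.univ ≠ ∞ := by
    intro hZ
    have := measure_univ (μ := gaussianMatrix 𝕜 β M N)
    rw [hg, hZ] at this
    simp at this
  have hfin : IsFiniteMeasure γ₀ := ⟨hZ.lt_top⟩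
  set μ := (η.prod (flatMeasure 𝕜 M N)).map polarProduct with hμ
  set p := β / 2 * ((M : ℝ) - N)
  set ν := (flatMeasure 𝕜 N N).withDensity (detWeight p) with hν
  have hγ := measurable_gaussianWeight (𝕜 := 𝕜) (M := N) (N := N) β
  have hγ0 : ∀ G : Matrix (Fin N) (Fin N) 𝕜, gaussianWeight β G ≠ 0 := fun G =>
    (ENNReal.ofReal_pos.2 (Real.exp_pos _)).ne'
  have hγt : ∀ G : Matrix (Fin N) (Fin N) 𝕜, gaussianWeight β G ≠ ∞ := fun G =>
    ENNReal.ofReal_ne_top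
  have hμγ : (η.prod γ₀).map polarProduct = μ.withDensity (gaussianWeight β) :=
    map_polarProduct_prod_withDensity β η
  -- Images of σ-finite measures need not be σ-finite. Here the Gaussian weight makes `μ` finite,
  -- and dividing by this positive finite weight recovers `μ`.
  have hμs : SigmaFinite μ := by
    have : IsFiniteMeasure (μ.withDensity (gaussianWeight β)) := by
      rw [← hμγ]
      infer_instance
    rw [← withDensity_inv_same (μ := μ) hγ (ae_of_all _ hγ0) (ae_of_all _ hγt)]
    exact SigmaFinite.withDensity_of_ne_top (ae_of_all _ fun G => ENNReal.inv_ne_top.2 (hγ0 G))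
  have hνs : SigmaFinite ν :=
    SigmaFinite.withDensity_of_ne_top (ae_of_all _ fun G => ENNReal.ofReal_ne_top)
  have hμu : ∀ᵐ G ∂μ, IsUnit G := by
    rw [hμ, ae_map_iff measurable_polarProduct.aemeasurable measurableSet_isUnit]
    have h := Measure.quasiMeasurePreserving_snd (μ := η) (ν := flatMeasure 𝕜 M N) |>.ae
      (ae_isUnit_conjTranspose_mul_self hMN)
    filter_upwards [h] with q hq
    exact isUnit_polarProduct hq
  have hνu : ∀ᵐ G ∂ν, IsUnit G :=
    (withDensity_absolutelyContinuous _ _).ae_le ae_isUnit_flatMeasure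
  have hν0 : ν ≠ 0 := by
    intro h
    have h1 := (withDensity_eq_zero_iff (measurable_detWeight p).aemeasurable).1 h
    apply flatMeasure_ne_zero (𝕜 := 𝕜) (M := N) (N := N)
    rw [← ae_eq_bot, ← Filter.eventually_false_iff_eq_bot]
    filter_upwards [h1, ae_isUnit_flatMeasure] with G hG hu
    exact detWeight_ne_zero p hu hG
  obtain ⟨c, hc⟩ := exists_eq_smul_of_map_mul_right_matrix μ ν hμu hνu hν0
    (fun A => ENNReal.ofReal (‖A.det‖ ^ β) ^ M)
    ((ENNReal.measurable_ofReal.comp (Measurable.pow_const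
      (by fun_prop : Continuous fun A : Matrix (Fin N) (Fin N) 𝕜 => ‖A.det‖).measurable β)).pow_const
        M)
    (fun A B => by
      rw [← mul_pow, ← ENNReal.ofReal_mul (by positivity), Matrix.det_mul, norm_mul,
        Real.mul_rpow (norm_nonneg _) (norm_nonneg _)])
    (fun A hA => pow_ne_zero _ (ENNReal.ofReal_pos.2 (Real.rpow_pos_of_pos (norm_pos_iff.2
      ((Matrix.isUnit_iff_isUnit_det A).1 hA).ne_zero) _)).ne')
    (fun A => ENNReal.pow_ne_top ENNReal.ofReal_ne_top)
    (map_mul_right_map_polarProduct hβ hMN η) (map_mul_right_flatMeasure_withDensity hβ)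
  set κ := (flatMeasure 𝕜 N N).withDensity fun G =>
    ENNReal.ofReal (RCLike.re (Gᴴ * G).det ^ (β / 2 * ((M : ℝ) - N)) *
      Real.exp (-(β / 2) * RCLike.re (Gᴴ * G).trace)) with hκ
  have hνκ : ν.withDensity (gaussianWeight β) = κ := by
    rw [hν, ← withDensity_mul _ (measurable_detWeight p) hγ, hκ]
    congr 1
    ext1 G
    rw [ENNReal.ofReal_mul (by rw [re_det_conjTranspose_mul_self]; positivity)]
    rfl
  have hfinal : (η.prod (gaussianMatrix 𝕜 β M N)).map polarProduct =
      ((γ₀ Set.univ)⁻¹ * c) • κ := by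
    rw [hg, Measure.prod_smul_right, Measure.map_smul, hμγ, hc, withDensity_smul_measure, hνκ,
      smul_smul]
  -- The left side of `hfinal` is a probability measure, which forces the unknown constant to be the
  -- inverse mass of `κ`.
  have hone : (γ₀ Set.univ)⁻¹ * c * κ Set.univ = 1 := by
    have := hlawP.measure_univ
    rwa [hfinal, Measure.smul_apply, smul_eq_mul] at this
  rw [hfinal, ENNReal.eq_inv_of_mul_eq_one_left hone]
  rfl

/-- If `U` is uniform on the unitary group and `X` is an independent Gaussian matrix, then
`U (Xᴴ X)^(1/2)` is an induced Ginibre matrix. -/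
theorem hasLaw_inducedGinibre {β : ℝ} (hβ : ∀ z : 𝕜, |Algebra.norm ℝ z| = ‖z‖ ^ β)
    (hMN : N ≤ M) {Ω : Type*} [MeasurableSpace Ω] {P : Measure Ω} [IsProbabilityMeasure P]
    {U : Ω → Matrix.unitaryGroup (Fin N) 𝕜} {X : Ω → Matrix (Fin M) (Fin N) 𝕜}
    (hU : IsHaarDistributed U P) (hX : HasLaw X (gaussianMatrix 𝕜 β M N) P)
    (hUX : IndepFun U X P) :
    HasLaw (fun ω => (U ω : Matrix (Fin N) (Fin N) 𝕜) * CFC.sqrt ((X ω)ᴴ * X ω))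
      (inducedGinibre 𝕜 β N ((M : ℝ) - N)) P := by
  obtain ⟨hUm, hUh⟩ := hU
  have hpair : AEMeasurable (fun ω => (U ω, X ω)) P := hUm.prodMk hX.aemeasurable
  have hη : IsProbabilityMeasure (P.map U) := Measure.isProbabilityMeasure_map hUm
  have hηr := isMulRightInvariant_of_isMulLeftInvariant (P.map U)
  have hgP : IsProbabilityMeasure (gaussianMatrix 𝕜 β M N) := by
    rw [← hX.map_eq]
    exact Measure.isProbabilityMeasure_map hX.aemeasurable
  have hlaw : P.map (polarProduct ∘ fun ω => (U ω, X ω)) = inducedGinibre 𝕜 β N ((M : ℝ) - N) := by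
    rw [← map_polarProduct_prod_gaussianMatrix hβ hMN (P.map U), ← hX.map_eq,
      ← (indepFun_iff_map_prod_eq_prod_map_map hUm hX.aemeasurable).1 hUX,
      AEMeasurable.map_map_of_aemeasurable measurable_polarProduct.aemeasurable hpair]
  exact ⟨measurable_polarProduct.comp_aemeasurable hpair, hlaw⟩

end Laws

end InducedGinibre

theorem lemma3 (M N : ℕ) (hMN : N ≤ M)
    {Ω : Type*} [MeasurableSpace Ω] (P : Measure Ω) [IsProbabilityMeasure P] :
    (∀ (U : Ω → Matrix.orthogonalGroup (Fin N) ℝ) (X : Ω → Matrix (Fin M) (Fin N) ℝ),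
      InducedGinibre.IsHaarDistributed U P →
      HasLaw X (InducedGinibre.gaussianMatrix ℝ 1 M N) P →
      IndepFun U X P →
      HasLaw (fun ω => (U ω : Matrix (Fin N) (Fin N) ℝ) * CFC.sqrt ((X ω)ᴴ * X ω))
        (InducedGinibre.inducedGinibre ℝ 1 N ((M : ℝ) - N)) P) ∧
    (∀ (U : Ω → Matrix.unitaryGroup (Fin N) ℂ) (X : Ω → Matrix (Fin M) (Fin N) ℂ),
      InducedGinibre.IsHaarDistributed U P →
      HasLaw X (InducedGinibre.gaussianMatrix ℂ 2 M N) P →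
      IndepFun U X P →
      HasLaw (fun ω => (U ω : Matrix (Fin N) (Fin N) ℂ) * CFC.sqrt ((X ω)ᴴ * X ω))
        (InducedGinibre.inducedGinibre ℂ 2 N ((M : ℝ) - N)) P) := by
  refine ⟨fun U X hU hX hUX => ?_, fun U X hU hX hUX => ?_⟩
  -- The field norm to `ℝ` has absolute value `‖z‖ ^ β`, with `β = 1` over `ℝ` and `β = 2` over `ℂ`.
  · exact InducedGinibre.hasLaw_inducedGinibre (by simp [Algebra.norm_self]) hMN hU hX hUX
  · exact InducedGinibre.hasLaw_inducedGinibre (by simp [Algebra.norm_complex_apply, Complex.normSq_eq_norm_sq]) hMN hU hX hUX
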